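/- Let $d\ge 1$, $\Omega\subseteq\mathbb{R}^d$ open, $T>0$, $1<p<\infty$, $0<s<1$, and write $L^1=L^1(\Omega)$ and $a^{p-1}:=|a|^{p-2}a$. Let $f:\Omega\times\mathbb{R}\to\mathbb{R}$ be such that $f(\cdot,r)$ is measurable for every $r\in\mathbb R$, and, for some $\omega>0$ and a.e. $x\in\Omega$, $f(x,0)=0$ and $|f(x,r_1)-f(x,r_2)|\le\omega|r_1-r_2|$ for all $r_1,r_2\in\mathbb{R}$. Let $\varphi:\mathbb{R}\to\mathbb{R}$ be strictly increasing with $\varphi(0)=0$. Notation. Let $[w]_{s,p}=\big(\iint_{\mathbb{R}^{2d}}\frac{|w(x)-w(y)|^p}{|x-y|^{d+sp}}\,dy\,dx\big)^{1/p}$ and $W^{s,p}(\mathbb{R}^d)=\{w\in L^p(\mathbb{R}^d): [w]_{s,p}<\infty\}$, with norm $(\|w\|_p^p+[w]_{s,p}^p)^{1/p}$. For $b:\mathbb{R}^d\setminus\Omega\to\mathbb{R}$, let $W^{s,p}_b(\Omega)=\{w\in W^{s,p}(\mathbb{R}^d): w=b \text{ a.e. on }\mathbb{R}^d\setminus\Omega\}$.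 For $w\in W^{s,p}(\mathbb{R}^d)$ and $k\in L^1$ we write $(-\Delta_p)^sw=k$ if $$\frac12\iint_{\mathbb{R}^{2d}}\frac{(w(x)-w(y))^{p-1}(v(x)-v(y))}{|x-y|^{d+sp}}\,dy\,dx=\int_\Omega k\,v\,dx$$ for every $v\in L^1(\mathbb{R}^d)\cap L^\infty(\mathbb{R}^d)$ with $[v]_{s,p}<\infty$ and $v=0$ a.e. on $\mathbb{R}^d\setminus\Omega$. Given $u_0\in L^1$, $g\in L^1((0,T);L^1)$ and exterior data $h(t)\in L^1_{\mathrm{loc}}(\mathbb{R}^d\setminus\Omega)$ for a.e. $t\in(0,T)$, a function $u\in W^{1,1}((0,T);L^1)$ (identified with its representative in $C([0,T];L^1)$, and extended to $\mathbb{R}^d$ by $u(t)=h(t)$ on $\mathbb{R}^d\setminus\Omega$) is called a strong distributional solution in $L^1$ of $$u_t+(-\Delta_p)^s\varphi(u)+f(\cdot,u)=g \text{ in }\Omega\times(0,T),\qquad u=h\text{ on }(\mathbb{R}^d\setminus\Omega)\times(0,T),\qquad u(0)=u_0 \text{ on }\Omega,$$ if $u(0)=u_0$, $\varphi(u)\in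 L^p_{\mathrm{loc}}((0,T);W^{s,p}(\mathbb{R}^d))$, and for a.e. $t\in(0,T)$ the function $u$ is differentiable at $t$ in $L^1$, $\varphi(u(t))\in W^{s,p}_{\varphi(h(t))}(\Omega)$ and $(-\Delta_p)^s\varphi(u(t))=g(t)-f(\cdot,u(t))-u_t(t)$. Theorem. Let $u$ and $\hat u$ be strong distributional solutions in $L^1$ of this problem (with the same $f$ and $\varphi$) for the initial data $u_0,\hat u_0\in L^1$, forcing terms $g,\hat g\in L^1((0,T);L^1)$ and exterior data $h,\hat h$ with $h(t),\hat h(t)\in L^1_{\mathrm{loc}}(\mathbb{R}^d\setminus\Omega)$ for a.e. $t\in(0,T)$, respectively. If $h(t)\le\hat h(t)$ a.e. on $\mathbb{R}^d\setminus\Omega$ for a.e. $t\in(0,T)$, then for all $0\le t\le T$ $$\int_\Omega (u(t)-\hat u(t))^+\,dx\le e^{\omega t}\int_\Omega(u_0-\hat u_0)^+\,dx+\int_0^te^{\omega(t-r)}\int_\Omega (g(r)-\hat g(r))\,\mathbf 1_{\{u(r)>\hat u(r)\}}\,dx\,dr .$$ -/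

import Mathlib

open MeasureTheory Set

namespace FracDNL

/-- Euclidean space `ℝ^d`. -/
abbrev Eucl (d : ℕ) : Type := EuclideanSpace ℝ (Fin d)

/-- The Banach space `L¹ = L¹(Ω)` with respect to Lebesgue measure on `Ω`. -/
noncomputable abbrev L1 {d : ℕ} (Ω : Set (Eucl d)) : Type :=
  Lp ℝ 1 ((volume : Measure (Eucl d)).restrict Ω)

/-- The odd power `r^m := |r|^(m-1) r`. -/
noncomputable def oddPow (r m : ℝ) : ℝ := |r| ^ (m - 1) * r

/-- The Gagliardo seminorm
`[w]_{s,p} = (∫∫ |w(x) - w(y)|^p / |x - y|^(d + s p) dy dx)^(1/p)` over `ℝ^d × ℝ^d`,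
with values in `[0, ∞]`. -/
noncomputable def gagliardo {d : ℕ} (s p : ℝ) (w : Eucl d → ℝ) : ENNReal :=
  (∫⁻ z : Eucl d × Eucl d,
    ENNReal.ofReal (|w z.1 - w z.2| ^ p / ‖z.1 - z.2‖ ^ ((d : ℝ) + s * p))) ^ (1 / p)

/-- Membership in the fractional Sobolev space `W^{s,p}(ℝ^d)`. -/
def MemWsp {d : ℕ} (s p : ℝ) (w : Eucl d → ℝ) : Prop :=
  MemLp w (ENNReal.ofReal p) volume ∧ gagliardo s p w < ⊤

/-- Membership in `W^{s,p}_b(Ω)`: functions of `W^{s,p}(ℝ^d)` that agree with `b` almost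
everywhere on `ℝ^d \ Ω`. -/
def MemWspBdry {d : ℕ} (Ω : Set (Eucl d)) (s p : ℝ) (b w : Eucl d → ℝ) : Prop :=
  MemWsp s p w ∧ ∀ᵐ x ∂((volume : Measure (Eucl d)).restrict Ωᶜ), w x = b x

/-- `(-Δ_p)^s w = k` on `Ω`, for `w ∈ W^{s,p}(ℝ^d)` and `k ∈ L¹(Ω)`: the variational equation
`½ ∫∫ (w(x)-w(y))^(p-1) (v(x)-v(y)) / |x-y|^(d+sp) dx dy = ∫_Ω k v dx`
holds for every `v ∈ L¹ ∩ L^∞` with `[v]_{s,p} < ∞` that vanishes a.e. outside `Ω`.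
(For such `w`, `k`, `v` both integrals converge absolutely.) -/
def IsFracPLaplacian {d : ℕ} (Ω : Set (Eucl d)) (s p : ℝ) (w k : Eucl d → ℝ) : Prop :=
  ∀ v : Eucl d → ℝ, MemLp v 1 volume → MemLp v ⊤ volume → gagliardo s p v < ⊤ →
    (∀ᵐ x ∂((volume : Measure (Eucl d)).restrict Ωᶜ), v x = 0) →
    (1 / 2 : ℝ) * ∫ z : Eucl d × Eucl d,
        oddPow (w z.1 - w z.2) (p - 1) * (v z.1 - v z.2) / ‖z.1 - z.2‖ ^ ((d : ℝ) + s * p)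
      = ∫ x in Ω, k x * v x

/-- `f : Ω × ℝ → ℝ` is a Lipschitz-continuous Carathéodory function with constant `ω > 0`
and `f(x, 0) = 0` for a.e. `x ∈ Ω`. -/
structure IsLipCaratheodory {d : ℕ} (Ω : Set (Eucl d)) (ω : ℝ) (f : Eucl d → ℝ → ℝ) :
    Prop where
  pos : 0 < ω
  measurable : ∀ r : ℝ, AEMeasurable (fun x => f x r) (volume.restrict Ω)
  lipschitz : ∀ᵐ x ∂((volume : Measure (Eucl d)).restrict Ω), ∀ r₁ r₂ : ℝ,
    |f x r₁ - f x r₂| ≤ ω * |r₁ - r₂|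
  zero : ∀ᵐ x ∂((volume : Measure (Eucl d)).restrict Ω), f x 0 = 0

/-- Membership of (the continuous representative) `u : [0,T] → X` in `W^{1,1}((0,T); X)`:
`u` is the primitive of a Bochner integrable function. -/
def MemW11 {X : Type*} [NormedAddCommGroup X] [NormedSpace ℝ X] (T : ℝ) (u : ℝ → X) : Prop :=
  ∃ u' : ℝ → X, IntegrableOn u' (Ioo 0 T) volume ∧
    ∀ t ∈ Icc (0 : ℝ) T, u t = u 0 + ∫ r in (0 : ℝ)..t, u' r

/-- Membership in `L^p_loc((0,T); W^{s,p}(ℝ^d))`. Strong measurability in time is expressed by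
the existence of a jointly measurable version. -/
def MemLpLocWsp {d : ℕ} (s p T : ℝ) (w : ℝ → Eucl d → ℝ) : Prop :=
  ∃ W : ℝ × Eucl d → ℝ,
    AEStronglyMeasurable W ((volume.restrict (Ioo (0 : ℝ) T)).prod volume) ∧
    (∀ᵐ t ∂((volume : Measure ℝ).restrict (Ioo 0 T)), ∀ᵐ x, W (t, x) = w t x) ∧
    ∀ a b : ℝ, 0 < a → a < b → b < T →
      ∫⁻ t in Icc a b, (eLpNorm (fun x => W (t, x)) (ENNReal.ofReal p) volume ^ p
        + gagliardo s p (fun x => W (t, x)) ^ p) < ⊤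

open Classical in
/-- The function on `ℝ^d` which is `u` on `Ω` and the exterior datum `b` on `ℝ^d \ Ω`. -/
noncomputable def extend {d : ℕ} (Ω : Set (Eucl d)) (u b : Eucl d → ℝ) : Eucl d → ℝ :=
  fun x => if x ∈ Ω then u x else b x

/-- `u` is a strong distributional solution in `L¹` of
`u_t + (-Δ_p)^s φ(u) + f(·,u) = g` on `Ω × (0,T)`, `u(t) = h(t)` on `ℝ^d \ Ω`, `u(0) = u₀`.
The unknown is `u : [0,T] → L¹(Ω)`, continued by `h(t)` outside `Ω`; `deriv u t` is the
derivative `u_t(t)` in `L¹(Ω)`. -/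
structure IsStrongDistribSolution {d : ℕ} (Ω : Set (Eucl d)) (s p T : ℝ) (φ : ℝ → ℝ)
    (f : Eucl d → ℝ → ℝ) (g : ℝ → L1 Ω) (h : ℝ → Eucl d → ℝ) (u₀ : L1 Ω)
    (u : ℝ → L1 Ω) : Prop where
  initial : u 0 = u₀
  memW11 : MemW11 T u
  memLpLoc : MemLpLocWsp s p T (fun t x => φ (extend Ω (u t) (h t) x))
  equation : ∀ᵐ t ∂((volume : Measure ℝ).restrict (Ioo 0 T)),
    DifferentiableAt ℝ u t ∧
    MemWspBdry Ω s p (fun x => φ (h t x)) (fun x => φ (extend Ω (u t) (h t) x)) ∧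
    IsFracPLaplacian Ω s p (fun x => φ (extend Ω (u t) (h t) x))
      (fun x => g t x - f x (u t x) - deriv u t x)

end FracDNL

/-! Let F(t) = ∫_Ω (u₁ - u₂)⁺. Formally, subtract the two equations and multiply by the indicator of
{u₁ > u₂}. As φ is strictly increasing, inside Ω this set is {w₁ > w₂} with wᵢ = φ(uᵢ), so the
multiplier is a nondecreasing function of w₁ - w₂. Its pairing with the difference of the nonlocal
terms is therefore nonnegative (`integral_indicator_lt_nonneg`). The Lipschitz term costs at most
ωF, which leaves F' ≤ ∫_{u₁ > u₂} (g₁ - g₂) + ωF almost everywhere (`setIntegral_deriv_le`), and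
Gronwall concludes.

Three points need care. The indicator is not known to be an admissible test function, so it is
approximated by `ramp`. The chain rule for the positive part comes from a minimum argument
(`deriv_integral_max_zero`). Gronwall needs F absolutely continuous and the forcing term integrable
in time, although its set of integration moves with time (`integrable_setIntegral_pos`). -/

namespace FracDNL

open Filter Topology

/-! ### The functional U ↦ ∫ U⁺ on L¹ -/

section PositivePart

variable {α : Type*} [MeasurableSpace α] {μ : Measure α}

lemma integrable_max_zero (U : Lp ℝ 1 μ) : Integrable (fun x => max (U x) 0) μ :=
  (L1.integrable_coeFn U).pos_part

lemma abs_integral_max_zero_sub_le (U V : Lp ℝ 1 μ) :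
    |(∫ x, max (U x) 0 ∂μ) - ∫ x, max (V x) 0 ∂μ| ≤ ‖U - V‖ := by
  rw [← integral_sub (integrable_max_zero U) (integrable_max_zero V), L1.norm_eq_integral_norm,
    ← Real.norm_eq_abs]
  refine (norm_integral_le_integral_norm _).trans ?_
  refine integral_mono_ae ((integrable_max_zero U).sub (integrable_max_zero V)).norm
    (L1.integrable_coeFn _).norm ?_
  filter_upwards [Lp.coeFn_sub U V] with x hx
  rw [hx, Pi.sub_apply, Real.norm_eq_abs, Real.norm_eq_abs]
  exact abs_max_sub_max_le_abs _ _ _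

lemma continuous_integral_max_zero :
    Continuous fun U : Lp ℝ 1 μ => ∫ x, max (U x) 0 ∂μ := by
  refine (LipschitzWith.of_dist_le_mul (K := 1) fun U V => ?_).continuous
  rw [Real.dist_eq, dist_eq_norm, NNReal.coe_one, one_mul]
  exact abs_integral_max_zero_sub_le U V

lemma measurableSet_pos (U : Lp ℝ 1 μ) : MeasurableSet {x | 0 < U x} :=
  measurableSet_lt measurable_const (Lp.stronglyMeasurable U).measurable

lemma setIntegral_le_integral_max_zero (S : Set α) (hS : MeasurableSet S) (V : Lp ℝ 1 μ) :
    ∫ x in S, V x ∂μ ≤ ∫ x, max (V x) 0 ∂μ := by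
  rw [← integral_indicator hS]
  refine integral_mono ((L1.integrable_coeFn V).indicator hS) (integrable_max_zero V) fun x => ?_
  by_cases hx : x ∈ S <;> simp [hx]

lemma setIntegral_pos_eq_integral_max_zero (U : Lp ℝ 1 μ) :
    ∫ x in {x | 0 < U x}, U x ∂μ = ∫ x, max (U x) 0 ∂μ := by
  rw [← integral_indicator (measurableSet_pos U)]
  refine integral_congr_ae (Eventually.of_forall fun x => ?_)
  by_cases hx : 0 < U x
  · simp [hx, hx.le]
  · simp [hx, not_lt.1 hx]

lemma norm_setIntegral_le (S : Set α) (V : Lp ℝ 1 μ) : ‖∫ x in S, V x ∂μ‖ ≤ ‖V‖ := by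
  rw [L1.norm_eq_integral_norm]
  exact (norm_integral_le_integral_norm _).trans
    (setIntegral_le_integral (L1.integrable_coeFn V).norm (Eventually.of_forall fun _ => norm_nonneg _))

/-- Integration over `S` as a continuous functional on `L¹`. -/
noncomputable def setIntegralCLM (μ : Measure α) (S : Set α) : Lp ℝ 1 μ →L[ℝ] ℝ :=
  LinearMap.mkContinuous
    { toFun := fun V => ∫ x in S, V x ∂μ
      map_add' := fun V W => by
        rw [← integral_add (L1.integrable_coeFn V).restrict (L1.integrable_coeFn W).restrict]
        exact integral_congr_ae (ae_restrict_of_ae (Lp.coeFn_add V W))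
      map_smul' := fun c V => by
        rw [RingHom.id_apply, ← integral_smul]
        exact integral_congr_ae (ae_restrict_of_ae (Lp.coeFn_smul c V)) }
    1 fun V => by simpa using norm_setIntegral_le S V

lemma setIntegralCLM_apply (S : Set α) (V : Lp ℝ 1 μ) :
    setIntegralCLM μ S V = ∫ x in S, V x ∂μ := rfl

/-- Where both sides are differentiable, `∫ U⁺` has derivative `∫_{U > 0} U'`. -/
lemma deriv_integral_max_zero {U : ℝ → Lp ℝ 1 μ} {t : ℝ} (hU : DifferentiableAt ℝ U t)
    (hF : DifferentiableAt ℝ (fun r => ∫ x, max (U r x) 0 ∂μ) t) :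
    deriv (fun r => ∫ x, max (U r x) 0 ∂μ) t = ∫ x in {x | 0 < U t x}, deriv U t x ∂μ := by
  have h1 : HasDerivAt (fun r => setIntegralCLM μ {x | 0 < U t x} (U r))
      (setIntegralCLM μ {x | 0 < U t x} (deriv U t)) t :=
    (setIntegralCLM μ _).hasFDerivAt.comp_hasDerivAt t hU.hasDerivAt
  -- The set is frozen at time t. The integral of `U r` over any fixed set is at most ∫ (U r)⁺, with
  -- equality at r = t, so the difference has a minimum there and its derivative vanishes.
  have hmin : IsLocalMin (fun r => (∫ x, max (U r x) 0 ∂μ) -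
      setIntegralCLM μ {x | 0 < U t x} (U r)) t := by
    refine Eventually.of_forall fun r => ?_
    simp only [setIntegralCLM_apply]
    rw [setIntegral_pos_eq_integral_max_zero, sub_self]
    exact sub_nonneg.2 (setIntegral_le_integral_max_zero _ (measurableSet_pos _) _)
  exact sub_eq_zero.1 (hmin.hasDerivAt_eq_zero (hF.hasDerivAt.sub h1))

/-- A one-sided directional derivative of ∫ U⁺. Approaching from below, by U - G/(n+1) with G ≥ 0,
makes {U = 0} contribute nothing; from above, that set would be added to {U > 0}. -/
lemma tendsto_slope_integral_max_zero (U G : Lp ℝ 1 μ) (hG : 0 ≤ᵐ[μ] G) :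
    Tendsto (fun n : ℕ => ((n : ℝ) + 1) * ((∫ x, max (U x) 0 ∂μ) -
      ∫ x, max ((U - ((n : ℝ) + 1)⁻¹ • G) x) 0 ∂μ)) atTop (𝓝 (∫ x in {x | 0 < U x}, G x ∂μ)) := by
  rw [← integral_indicator (measurableSet_pos U)]
  simp_rw [← integral_sub (integrable_max_zero U) (integrable_max_zero _), ← integral_const_mul]
  refine tendsto_integral_of_dominated_convergence (fun x => |G x|)
    (fun n => (((integrable_max_zero U).sub (integrable_max_zero _)).const_mul _).1)
    (L1.integrable_coeFn G).abs (fun n => ?_) ?_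
  · filter_upwards [Lp.coeFn_sub U (((n : ℝ) + 1)⁻¹ • G), Lp.coeFn_smul ((n : ℝ) + 1)⁻¹ G]
      with x h1 h2
    have hn : (0 : ℝ) < (n : ℝ) + 1 := by positivity
    rw [h1, Pi.sub_apply, h2, Pi.smul_apply, smul_eq_mul, Real.norm_eq_abs, abs_mul,
      abs_of_pos hn]
    calc _ ≤ ((n : ℝ) + 1) * |U x - (U x - ((n : ℝ) + 1)⁻¹ * G x)| := by
          exact mul_le_mul_of_nonneg_left (abs_max_sub_max_le_abs _ _ _) hn.le
      _ = |G x| := by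
          rw [sub_sub_cancel, abs_mul, abs_of_pos (inv_pos.2 hn), mul_inv_cancel_left₀ hn.ne']
  · have h1 : ∀ᵐ x ∂μ, ∀ n : ℕ, (U - ((n : ℝ) + 1)⁻¹ • G) x = U x - ((n : ℝ) + 1)⁻¹ * G x := by
      rw [ae_all_iff]
      intro n
      filter_upwards [Lp.coeFn_sub U (((n : ℝ) + 1)⁻¹ • G), Lp.coeFn_smul ((n : ℝ) + 1)⁻¹ G]
        with x h1 h2
      rw [h1, Pi.sub_apply, h2, Pi.smul_apply, smul_eq_mul]
    filter_upwards [h1, hG] with x hx hGx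
    simp_rw [hx]
    have hGx : 0 ≤ G x := hGx
    by_cases hU : 0 < U x
    · rw [indicator_of_mem (show x ∈ {x | 0 < U x} from hU)]
      refine tendsto_const_nhds.congr' ?_
      have hlim : Tendsto (fun n : ℕ => U x - ((n : ℝ) + 1)⁻¹ * G x) atTop (𝓝 (U x - 0 * G x)) := by
        refine tendsto_const_nhds.sub (Tendsto.mul_const _ ?_)
        simpa using tendsto_one_div_add_atTop_nhds_zero_nat (𝕜 := ℝ)
      rw [zero_mul, sub_zero] at hlim
      filter_upwards [hlim.eventually_const_lt hU] with n hn
      have : (0 : ℝ) < (n : ℝ) + 1 := by positivity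
      rw [max_eq_left hU.le, max_eq_left hn.le, sub_sub_cancel, mul_inv_cancel_left₀ this.ne']
    · rw [indicator_of_notMem (show x ∉ {x | 0 < U x} from hU)]
      refine tendsto_const_nhds.congr fun n => ?_
      have : (0 : ℝ) ≤ ((n : ℝ) + 1)⁻¹ * G x := by positivity
      rw [max_eq_right (not_lt.1 hU), max_eq_right (by linarith [not_lt.1 hU])]
      simp

/-- For G ≥ 0 the integral is a pointwise limit of difference quotients of the continuous functional
∫ U⁺, hence measurable in r; a general G is split into G⁺ - G⁻. -/
lemma aestronglyMeasurable_setIntegral_pos {β : Type*} [MeasurableSpace β] {ν : Measure β}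
    {U G : β → Lp ℝ 1 μ} (hU : AEStronglyMeasurable U ν) (hG : AEStronglyMeasurable G ν) :
    AEStronglyMeasurable (fun r => ∫ x in {x | 0 < U r x}, G r x ∂μ) ν := by
  have key : ∀ G : β → Lp ℝ 1 μ, AEStronglyMeasurable G ν → (∀ r, 0 ≤ᵐ[μ] G r) →
      AEStronglyMeasurable (fun r => ∫ x in {x | 0 < U r x}, G r x ∂μ) ν := by
    intro G hG hpos
    refine aestronglyMeasurable_of_tendsto_ae atTop (fun n => ?_)
      (Eventually.of_forall fun r => tendsto_slope_integral_max_zero (U r) (G r) (hpos r))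
    have h : AEStronglyMeasurable (fun r => U r - ((n : ℝ) + 1)⁻¹ • G r) ν :=
      hU.sub (hG.const_smul ((n : ℝ) + 1)⁻¹)
    have h1 := (continuous_integral_max_zero (μ := μ)).comp_aestronglyMeasurable hU
    have h2 := (continuous_integral_max_zero (μ := μ)).comp_aestronglyMeasurable h
    exact (h1.sub h2).const_mul _
  have h1 := key (fun r => Lp.posPart (G r)) (Lp.continuous_posPart.comp_aestronglyMeasurable hG)
    fun r => by
      filter_upwards [Lp.coeFn_posPart (G r)] with x hx
      rw [hx]; exact le_max_right _ _
  have h2 := key (fun r => Lp.negPart (G r)) (Lp.continuous_negPart.comp_aestronglyMeasurable hG)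
    fun r => by
      filter_upwards [Lp.coeFn_negPart_eq_max (G r)] with x hx
      rw [hx]; exact le_max_right _ _
  refine (h1.sub h2).congr (Eventually.of_forall fun r => ?_)
  simp only [Pi.sub_apply]
  rw [← integral_sub (L1.integrable_coeFn _).restrict (L1.integrable_coeFn _).restrict]
  refine integral_congr_ae (ae_restrict_of_ae ?_)
  filter_upwards [Lp.coeFn_posPart (G r), Lp.coeFn_negPart_eq_max (G r)] with x hx hx'
  rw [hx, hx']
  rcases le_total 0 (G r x) with h | h
  · simp [h]
  · simp [h]

lemma integrable_setIntegral_pos {β : Type*} [MeasurableSpace β] {ν : Measure β}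
    {U G : β → Lp ℝ 1 μ} (hU : AEStronglyMeasurable U ν) (hG : Integrable G ν) :
    Integrable (fun r => ∫ x in {x | 0 < U r x}, G r x ∂μ) ν :=
  hG.norm.mono' (aestronglyMeasurable_setIntegral_pos hU hG.1)
    (Eventually.of_forall fun _ => norm_setIntegral_le _ _)

end PositivePart

/-! ### Absolute continuity of W^{1,1} functions of time -/

section AbsolutelyContinuous

/-- Serves twice: to compare a Bochner primitive with the primitive of ‖u'‖, and ∫ U⁺ with U itself.
-/
lemma _root_.AbsolutelyContinuousOnInterval.of_dist_le {X Y : Type*} [PseudoMetricSpace X]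
    [PseudoMetricSpace Y] {f : ℝ → X} {g : ℝ → Y} {a b : ℝ}
    (hg : AbsolutelyContinuousOnInterval g a b)
    (hfg : ∀ x ∈ uIcc a b, ∀ y ∈ uIcc a b, dist (f x) (f y) ≤ dist (g x) (g y)) :
    AbsolutelyContinuousOnInterval f a b := by
  rw [absolutelyContinuousOnInterval_iff] at hg ⊢
  intro ε hε
  obtain ⟨δ, hδ, h⟩ := hg ε hε
  refine ⟨δ, hδ, fun E hE hlt => lt_of_le_of_lt (Finset.sum_le_sum fun i hi => ?_) (h E hE hlt)⟩
  exact hfg _ (hE.1 i hi).1 _ (hE.1 i hi).2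

variable {X : Type*} [NormedAddCommGroup X] [NormedSpace ℝ X] {T : ℝ} {u v : ℝ → X}

lemma MemW11.sub (hu : MemW11 T u) (hv : MemW11 T v) :
    MemW11 T (fun t => u t - v t) := by
  obtain ⟨u', hu', hu⟩ := hu
  obtain ⟨v', hv', hv⟩ := hv
  refine ⟨fun r => u' r - v' r, hu'.sub hv', fun t ht => ?_⟩
  have hi : ∀ w : ℝ → X, IntegrableOn w (Ioo 0 T) volume → IntervalIntegrable w volume 0 t := by
    intro w hw
    rw [intervalIntegrable_iff_integrableOn_Ioo_of_le ht.1]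
    exact hw.mono_set (Ioo_subset_Ioo_right ht.2)
  beta_reduce
  rw [hu t ht, hv t ht, intervalIntegral.integral_sub (hi _ hu') (hi _ hv')]
  abel

lemma MemW11.absolutelyContinuousOnInterval (hT : 0 ≤ T) (hu : MemW11 T u) :
    AbsolutelyContinuousOnInterval u 0 T := by
  obtain ⟨u', hu', hu⟩ := hu
  have hi : IntervalIntegrable u' volume 0 T :=
    (intervalIntegrable_iff_integrableOn_Ioo_of_le hT).2 hu'
  refine (hi.norm.absolutelyContinuousOnInterval_intervalIntegral left_mem_uIcc).of_dist_le
    fun x hx y hy => ?_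
  have h0 : ∀ z ∈ uIcc 0 T, IntervalIntegrable u' volume 0 z := fun z hz =>
    hi.mono_set (uIcc_subset_uIcc left_mem_uIcc hz)
  have hx' := hx
  have hy' := hy
  rw [uIcc_of_le hT] at hx' hy'
  rw [dist_eq_norm, Real.dist_eq, hu x hx', hu y hy', add_sub_add_left_eq_sub,
    intervalIntegral.integral_interval_sub_left (h0 x hx) (h0 y hy),
    intervalIntegral.integral_interval_sub_left (h0 x hx).norm (h0 y hy).norm]
  exact intervalIntegral.norm_integral_le_abs_integral_norm

end AbsolutelyContinuous

/-! ### Elementary inequalities, odd powers and the ramp -/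

lemma add_rpow_le_two_rpow_mul {a b p : ℝ} (ha : 0 ≤ a) (hb : 0 ≤ b) (hp : 0 ≤ p) :
    (a + b) ^ p ≤ 2 ^ p * (a ^ p + b ^ p) := by
  have h1 : a + b ≤ 2 * max a b := by linarith [le_max_left a b, le_max_right a b]
  have h2 : (max a b) ^ p ≤ a ^ p + b ^ p := by
    rcases max_choice a b with h | h <;> rw [h]
    · linarith [Real.rpow_nonneg hb p]
    · linarith [Real.rpow_nonneg ha p]
  calc (a + b) ^ p ≤ (2 * max a b) ^ p := Real.rpow_le_rpow (by positivity) h1 hp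
    _ = 2 ^ p * (max a b) ^ p := Real.mul_rpow (by norm_num) (le_max_of_le_left ha)
    _ ≤ _ := by gcongr

/-- A crude Young inequality, by replacing the smaller of a and c with the larger. It dominates the
weak form by two Gagliardo integrands. -/
lemma rpow_sub_one_mul_le {a c p : ℝ} (ha : 0 ≤ a) (hc : 0 ≤ c) (hp : 1 < p) :
    a ^ (p - 1) * c ≤ a ^ p + c ^ p := by
  have key : ∀ m : ℝ, 0 ≤ m → m ^ (p - 1) * m = m ^ p := fun m hm => by
    have := Real.rpow_add_one' hm (y := p - 1) (by linarith)
    rw [← this, sub_add_cancel]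
  have hp' : 0 ≤ p - 1 := by linarith
  rcases le_total a c with h | h
  · calc a ^ (p - 1) * c ≤ c ^ (p - 1) * c := by gcongr
      _ = c ^ p := key c hc
      _ ≤ _ := by linarith [Real.rpow_nonneg ha p]
  · calc a ^ (p - 1) * c ≤ a ^ (p - 1) * a := by gcongr
      _ = a ^ p := key a ha
      _ ≤ _ := by linarith [Real.rpow_nonneg hc p]

lemma oddPow_of_nonneg {r m : ℝ} (hr : 0 ≤ r) (hm : 0 < m) : oddPow r m = r ^ m := by
  have := Real.rpow_add_one' hr (y := m - 1) (by linarith)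
  rw [oddPow, abs_of_nonneg hr, ← this, sub_add_cancel]

lemma oddPow_neg (r m : ℝ) : oddPow (-r) m = -oddPow r m := by
  simp [oddPow]

lemma abs_oddPow {r m : ℝ} (hm : 0 < m) : |oddPow r m| = |r| ^ m := by
  rw [← oddPow_of_nonneg (abs_nonneg r) hm]
  simp [oddPow, abs_mul, abs_of_nonneg (Real.rpow_nonneg (abs_nonneg r) _)]

lemma monotone_oddPow {m : ℝ} (hm : 0 < m) : Monotone fun r => oddPow r m := by
  have hpos : ∀ r : ℝ, 0 ≤ r → 0 ≤ oddPow r m := fun r hr => by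
    rw [oddPow_of_nonneg hr hm]; positivity
  have hmono : ∀ a b : ℝ, 0 ≤ a → a ≤ b → oddPow a m ≤ oddPow b m := fun a b ha hab => by
    rw [oddPow_of_nonneg ha hm, oddPow_of_nonneg (ha.trans hab) hm]
    gcongr
  intro a b hab
  change oddPow a m ≤ oddPow b m
  rcases le_total 0 a with ha | ha
  · exact hmono a b ha hab
  · rcases le_total 0 b with hb | hb
    · have := hpos (-a) (by linarith)
      rw [oddPow_neg] at this
      linarith [hpos b hb]
    · have := hmono (-b) (-a) (by linarith) (by linarith)
      rw [oddPow_neg, oddPow_neg] at this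
      linarith

lemma measurable_oddPow (m : ℝ) : Measurable fun r => oddPow r m := by
  unfold oddPow
  fun_prop

/-- A Lipschitz approximation of the indicator of `(0, ∞)` vanishing on `(-∞, ε]`. -/
noncomputable def ramp (ε r : ℝ) : ℝ := min 1 (max 0 ((r - ε) / ε))

lemma ramp_nonneg (ε r : ℝ) : 0 ≤ ramp ε r := le_min zero_le_one (le_max_left _ _)

lemma ramp_le_one (ε r : ℝ) : ramp ε r ≤ 1 := min_le_left _ _

lemma abs_ramp_le_one (ε r : ℝ) : |ramp ε r| ≤ 1 := by
  rw [abs_of_nonneg (ramp_nonneg ε r)]; exact ramp_le_one ε r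

lemma ramp_of_le {ε r : ℝ} (hε : 0 < ε) (hr : r ≤ ε) : ramp ε r = 0 := by
  have : (r - ε) / ε ≤ 0 := div_nonpos_of_nonpos_of_nonneg (by linarith) hε.le
  simp [ramp, this]

lemma ramp_of_two_mul_le {ε r : ℝ} (hε : 0 < ε) (hr : 2 * ε ≤ r) : ramp ε r = 1 := by
  have : 1 ≤ (r - ε) / ε := by rw [le_div_iff₀ hε]; linarith
  rw [ramp, max_eq_right (by linarith), min_eq_left this]

lemma monotone_ramp {ε : ℝ} (hε : 0 < ε) : Monotone (ramp ε) := by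
  intro a b hab
  unfold ramp
  gcongr

lemma continuous_ramp (ε : ℝ) : Continuous (ramp ε) := by
  unfold ramp
  fun_prop

lemma abs_ramp_sub_le {ε : ℝ} (hε : 0 < ε) (a b : ℝ) :
    |ramp ε a - ramp ε b| ≤ ε⁻¹ * |a - b| := by
  have h1 : |ramp ε a - ramp ε b| ≤ |max 0 ((a - ε) / ε) - max 0 ((b - ε) / ε)| := by
    unfold ramp
    rw [min_comm 1, min_comm 1]
    exact abs_inf_sub_inf_le_abs _ _ _
  have h2 : |max 0 ((a - ε) / ε) - max 0 ((b - ε) / ε)| ≤ |(a - ε) / ε - (b - ε) / ε| := by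
    rw [max_comm 0, max_comm 0]
    exact abs_max_sub_max_le_abs _ _ _
  refine (h1.trans h2).trans_eq ?_
  rw [← sub_div, sub_sub_sub_cancel_right, abs_div, abs_of_pos hε, div_eq_inv_mul]

/-- Because the ramp vanishes up to ε, and not merely up to 0, an L^p function is turned into an L¹
function, as test functions must be. -/
lemma ramp_le_rpow {ε : ℝ} (hε : 0 < ε) {p : ℝ} (hp : 0 < p) (r : ℝ) :
    ramp ε r ≤ (ε⁻¹) ^ p * |r| ^ p := by
  rcases le_total r ε with h | h
  · rw [ramp_of_le hε h]; positivity
  · refine (ramp_le_one ε r).trans ?_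
    rw [← Real.mul_rpow (by positivity) (abs_nonneg r)]
    refine Real.one_le_rpow ?_ hp.le
    rw [← div_eq_inv_mul, le_div_iff₀ hε, one_mul]
    exact h.trans (le_abs_self r)

lemma tendsto_ramp (r : ℝ) :
    Tendsto (fun n : ℕ => ramp (1 / ((n : ℝ) + 1)) r) atTop (𝓝 (if 0 < r then 1 else 0)) := by
  split_ifs with h
  · refine tendsto_const_nhds.congr' ?_
    have hlim : Tendsto (fun n : ℕ => 2 * (1 / ((n : ℝ) + 1))) atTop (𝓝 (2 * 0)) :=
      (tendsto_one_div_add_atTop_nhds_zero_nat (𝕜 := ℝ)).const_mul 2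
    rw [mul_zero] at hlim
    filter_upwards [hlim.eventually_lt_const h] with n hn
    exact (ramp_of_two_mul_le (by positivity) hn.le).symm
  · refine tendsto_const_nhds.congr fun n => ?_
    have : (0 : ℝ) < 1 / ((n : ℝ) + 1) := by positivity
    exact (ramp_of_le this (by linarith [not_lt.1 h])).symm

/-! ### Gagliardo seminorm and T-accretivity -/

section Gagliardo

variable {d : ℕ} {s p : ℝ}

lemma aestronglyMeasurable_diff {w : Eucl d → ℝ} (hw : AEStronglyMeasurable w volume) :
    AEStronglyMeasurable (fun z : Eucl d × Eucl d => w z.1 - w z.2) volume :=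
  hw.comp_fst.sub hw.comp_snd

lemma measurable_norm_rpow (a : ℝ) :
    Measurable (fun z : Eucl d × Eucl d => ‖z.1 - z.2‖ ^ a) := by
  fun_prop

lemma aestronglyMeasurable_gagliardo_integrand {w : Eucl d → ℝ}
    (hw : AEStronglyMeasurable w volume) :
    AEStronglyMeasurable (fun z : Eucl d × Eucl d =>
      |w z.1 - w z.2| ^ p / ‖z.1 - z.2‖ ^ ((d : ℝ) + s * p)) volume :=
  (((aestronglyMeasurable_diff hw).aemeasurable.abs.pow_const p).div
    (measurable_norm_rpow _).aemeasurable).aestronglyMeasurable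

lemma gagliardo_lt_top_iff (hp : 0 < p) {w : Eucl d → ℝ} (hw : AEStronglyMeasurable w volume) :
    gagliardo s p w < ⊤ ↔ Integrable (fun z : Eucl d × Eucl d =>
      |w z.1 - w z.2| ^ p / ‖z.1 - z.2‖ ^ ((d : ℝ) + s * p)) := by
  rw [gagliardo, ENNReal.rpow_lt_top_iff_of_pos (by positivity), Integrable,
    hasFiniteIntegral_iff_ofReal (Eventually.of_forall fun z => by positivity)]
  exact ⟨fun h => ⟨aestronglyMeasurable_gagliardo_integrand hw, h⟩, fun h => h.2⟩

lemma abs_ramp_sub_rpow_le (hp : 0 < p) {ε : ℝ} (hε : 0 < ε) (a₁ a₂ b₁ b₂ : ℝ) :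
    |ramp ε (a₁ - a₂) - ramp ε (b₁ - b₂)| ^ p ≤
      (ε⁻¹) ^ p * 2 ^ p * (|a₁ - b₁| ^ p + |a₂ - b₂| ^ p) := by
  have hle : |(a₁ - a₂) - (b₁ - b₂)| ≤ |a₁ - b₁| + |a₂ - b₂| := by
    rw [sub_sub_sub_comm]; exact abs_sub _ _
  have hinv : 0 ≤ ε⁻¹ := inv_nonneg.2 hε.le
  calc |ramp ε (a₁ - a₂) - ramp ε (b₁ - b₂)| ^ p
      ≤ (ε⁻¹ * (|a₁ - b₁| + |a₂ - b₂|)) ^ p :=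
        Real.rpow_le_rpow (abs_nonneg _) ((abs_ramp_sub_le hε _ _).trans
          (mul_le_mul_of_nonneg_left hle hinv)) hp.le
    _ = (ε⁻¹) ^ p * (|a₁ - b₁| + |a₂ - b₂|) ^ p :=
        Real.mul_rpow hinv (by positivity)
    _ ≤ (ε⁻¹) ^ p * (2 ^ p * (|a₁ - b₁| ^ p + |a₂ - b₂| ^ p)) :=
        mul_le_mul_of_nonneg_left
          (add_rpow_le_two_rpow_mul (abs_nonneg _) (abs_nonneg _) hp.le) (by positivity)
    _ = _ := (mul_assoc _ _ _).symm

lemma gagliardo_ramp_lt_top (hp : 0 < p) {ε : ℝ} (hε : 0 < ε) {w₁ w₂ : Eucl d → ℝ}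
    (hm₁ : AEStronglyMeasurable w₁ volume) (hm₂ : AEStronglyMeasurable w₂ volume)
    (h₁ : gagliardo s p w₁ < ⊤) (h₂ : gagliardo s p w₂ < ⊤) :
    gagliardo s p (fun x => ramp ε (w₁ x - w₂ x)) < ⊤ := by
  have hm : AEStronglyMeasurable (fun x => ramp ε (w₁ x - w₂ x)) volume :=
    (continuous_ramp ε).comp_aestronglyMeasurable (hm₁.sub hm₂)
  rw [gagliardo_lt_top_iff hp hm]
  rw [gagliardo_lt_top_iff hp hm₁] at h₁
  rw [gagliardo_lt_top_iff hp hm₂] at h₂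
  obtain ⟨C, hC⟩ : ∃ C : ℝ, ∀ a₁ a₂ b₁ b₂ : ℝ, |ramp ε (a₁ - a₂) - ramp ε (b₁ - b₂)| ^ p ≤
      C * (|a₁ - b₁| ^ p + |a₂ - b₂| ^ p) := ⟨_, abs_ramp_sub_rpow_le hp hε⟩
  have hmono := (h₁.add h₂).const_mul C
  have hmeas := aestronglyMeasurable_gagliardo_integrand (s := s) (p := p) hm
  refine Integrable.mono' hmono hmeas (ae_of_all _ ?_)
  intro z
  have hN : 0 ≤ ‖z.1 - z.2‖ ^ ((d : ℝ) + s * p) := Real.rpow_nonneg (norm_nonneg _) _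
  have hle := div_le_div_of_nonneg_right (hC (w₁ z.1) (w₂ z.1) (w₁ z.2) (w₂ z.2)) hN
  rw [mul_div_assoc, add_div] at hle
  refine le_trans (le_of_eq ?_) hle
  exact Real.norm_of_nonneg (div_nonneg (Real.rpow_nonneg (abs_nonneg _) _) hN)

lemma integrable_weakForm (hp : 1 < p) {w v : Eucl d → ℝ}
    (hmw : AEStronglyMeasurable w volume) (hmv : AEStronglyMeasurable v volume)
    (hw : gagliardo s p w < ⊤) (hv : gagliardo s p v < ⊤) :
    Integrable (fun z : Eucl d × Eucl d =>
      oddPow (w z.1 - w z.2) (p - 1) * (v z.1 - v z.2) / ‖z.1 - z.2‖ ^ ((d : ℝ) + s * p)) := by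
  have hp0 : 0 < p := by linarith
  rw [gagliardo_lt_top_iff hp0 hmw] at hw
  rw [gagliardo_lt_top_iff hp0 hmv] at hv
  refine (hw.add hv).mono' ?_ (Eventually.of_forall fun z => ?_)
  · exact ((((measurable_oddPow (p - 1)).comp_aemeasurable
      (aestronglyMeasurable_diff hmw).aemeasurable).mul
      (aestronglyMeasurable_diff hmv).aemeasurable).div
      (measurable_norm_rpow _).aemeasurable).aestronglyMeasurable
  · have hN : 0 ≤ ‖z.1 - z.2‖ ^ ((d : ℝ) + s * p) := by positivity
    rw [Pi.add_apply, ← add_div, Real.norm_eq_abs, abs_div, abs_mul, abs_of_nonneg hN,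
      abs_oddPow (by linarith)]
    gcongr
    exact rpow_sub_one_mul_le (abs_nonneg _) (abs_nonneg _) hp

lemma integrable_ramp (hp : 0 < p) {ε : ℝ} (hε : 0 < ε) {w : Eucl d → ℝ}
    (hw : MemLp w (ENNReal.ofReal p) volume) : Integrable (fun x => ramp ε (w x)) := by
  have hint := hw.integrable_norm_rpow (by simpa using hp) ENNReal.ofReal_ne_top
  rw [ENNReal.toReal_ofReal hp.le] at hint
  refine (hint.const_mul ((ε⁻¹) ^ p)).mono'
    ((continuous_ramp ε).comp_aestronglyMeasurable hw.1) (Eventually.of_forall fun x => ?_)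
  rw [Real.norm_of_nonneg (ramp_nonneg _ _), Real.norm_eq_abs]
  exact ramp_le_rpow hε hp _

/-- Both equations are tested with v = `ramp ε (w₁ - w₂)`. In the difference of the double
integrals, the two factors have the same sign: w₁(x) - w₁(y) ≥ w₂(x) - w₂(y) exactly when (w₁ -
w₂)(x) ≥ (w₁ - w₂)(y), and both the odd power and the ramp are monotone. -/
lemma integral_mul_ramp_nonneg (hp : 1 < p) {Ω : Set (Eucl d)}
    {ε : ℝ} (hε : 0 < ε) {w₁ w₂ k₁ k₂ : Eucl d → ℝ}
    (hw₁ : MemWsp s p w₁) (hw₂ : MemWsp s p w₂)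
    (hk₁ : IntegrableOn k₁ Ω volume) (hk₂ : IntegrableOn k₂ Ω volume)
    (he₁ : IsFracPLaplacian Ω s p w₁ k₁) (he₂ : IsFracPLaplacian Ω s p w₂ k₂)
    (hle : ∀ᵐ x ∂((volume : Measure (Eucl d)).restrict Ωᶜ), w₁ x ≤ w₂ x) :
    0 ≤ ∫ x in Ω, (k₁ x - k₂ x) * ramp ε (w₁ x - w₂ x) := by
  have hp0 : 0 < p := by linarith
  set v : Eucl d → ℝ := fun x => ramp ε (w₁ x - w₂ x) with hv
  have hmv : AEStronglyMeasurable v volume :=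
    (continuous_ramp ε).comp_aestronglyMeasurable (hw₁.1.1.sub hw₂.1.1)
  have hv1 : MemLp v 1 volume := memLp_one_iff_integrable.2 (integrable_ramp hp0 hε (hw₁.1.sub hw₂.1))
  have hvtop : MemLp v ⊤ volume :=
    memLp_top_of_bound hmv 1 (Eventually.of_forall fun x => abs_ramp_le_one _ _)
  have hvg : gagliardo s p v < ⊤ := gagliardo_ramp_lt_top hp0 hε hw₁.1.1 hw₂.1.1 hw₁.2 hw₂.2
  -- The ordering of the exterior data makes v vanish outside Ω.
  have hv0 : ∀ᵐ x ∂((volume : Measure (Eucl d)).restrict Ωᶜ), v x = 0 := by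
    filter_upwards [hle] with x hx
    exact ramp_of_le hε (by linarith)
  have e₁ := he₁ v hv1 hvtop hvg hv0
  have e₂ := he₂ v hv1 hvtop hvg hv0
  have hbd : ∀ᵐ x ∂((volume : Measure (Eucl d)).restrict Ω), ‖v x‖ ≤ 1 :=
    Eventually.of_forall fun x => abs_ramp_le_one _ _
  have i₁ : Integrable (fun x => k₁ x * v x) (volume.restrict Ω) :=
    hk₁.mul_bdd hmv.restrict hbd
  have i₂ : Integrable (fun x => k₂ x * v x) (volume.restrict Ω) :=
    hk₂.mul_bdd hmv.restrict hbd
  have hsplit : ∫ x in Ω, (k₁ x - k₂ x) * v x = (∫ x in Ω, k₁ x * v x) - ∫ x in Ω, k₂ x * v x := by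
    rw [← integral_sub i₁ i₂]
    simp_rw [sub_mul]
  rw [hsplit, ← e₁, ← e₂, ← mul_sub, ← integral_sub
    (integrable_weakForm hp hw₁.1.1 hmv hw₁.2 hvg) (integrable_weakForm hp hw₂.1.1 hmv hw₂.2 hvg)]
  refine mul_nonneg (by norm_num) (integral_nonneg fun z => ?_)
  simp only [Pi.zero_apply]
  rw [← sub_div, ← sub_mul]
  refine div_nonneg ?_ (by positivity)
  rcases le_total (w₁ z.1 - w₂ z.1) (w₁ z.2 - w₂ z.2) with h | h
  · exact mul_nonneg_of_nonpos_of_nonpos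
      (sub_nonpos.2 (monotone_oddPow (by linarith) (by linarith)))
      (sub_nonpos.2 (monotone_ramp hε h))
  · exact mul_nonneg
      (sub_nonneg.2 (monotone_oddPow (by linarith) (by linarith)))
      (sub_nonneg.2 (monotone_ramp hε h))

/-- T-accretivity of the fractional `p`-Laplacian in `L¹(Ω)`. -/
lemma integral_indicator_lt_nonneg (hp : 1 < p) {Ω : Set (Eucl d)} {w₁ w₂ k₁ k₂ : Eucl d → ℝ}
    (hw₁ : MemWsp s p w₁) (hw₂ : MemWsp s p w₂)
    (hk₁ : IntegrableOn k₁ Ω volume) (hk₂ : IntegrableOn k₂ Ω volume)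
    (he₁ : IsFracPLaplacian Ω s p w₁ k₁) (he₂ : IsFracPLaplacian Ω s p w₂ k₂)
    (hle : ∀ᵐ x ∂((volume : Measure (Eucl d)).restrict Ωᶜ), w₁ x ≤ w₂ x) :
    0 ≤ ∫ x in Ω, {x | w₂ x < w₁ x}.indicator (fun x => k₁ x - k₂ x) x := by
  have hk := hk₁.sub hk₂
  have hlim : Tendsto (fun n : ℕ => ∫ x in Ω, (k₁ x - k₂ x) * ramp (1 / ((n : ℝ) + 1)) (w₁ x - w₂ x))
      atTop (𝓝 (∫ x in Ω, {x | w₂ x < w₁ x}.indicator (fun x => k₁ x - k₂ x) x)) := by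
    refine tendsto_integral_of_dominated_convergence (fun x => ‖k₁ x - k₂ x‖) (fun n => ?_)
      hk.norm (fun n => Eventually.of_forall fun x => ?_) (Eventually.of_forall fun x => ?_)
    · exact hk.1.mul ((continuous_ramp _).comp_aestronglyMeasurable
        (hw₁.1.1.sub hw₂.1.1).restrict)
    · rw [norm_mul]
      exact mul_le_of_le_one_right (norm_nonneg _) (abs_ramp_le_one _ _)
    · have := (tendsto_ramp (w₁ x - w₂ x)).const_mul (k₁ x - k₂ x)
      convert this using 2
      by_cases h : w₂ x < w₁ x <;> simp [h]
  exact ge_of_tendsto' hlim fun n =>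
    integral_mul_ramp_nonneg hp (by positivity) hw₁ hw₂ hk₁ hk₂ he₁ he₂ hle

end Gagliardo

/-! ### Integrability of f(·, u) -/

section Nemytskii

variable {d : ℕ} {Ω : Set (Eucl d)} {ω : ℝ} {f : Eucl d → ℝ → ℝ}

lemma IsLipCaratheodory.aemeasurable_comp_simpleFunc (hf : IsLipCaratheodory Ω ω f)
    (φ : SimpleFunc (Eucl d) ℝ) : AEMeasurable (fun x => f x (φ x)) (volume.restrict Ω) := by
  have h : (fun x => f x (φ x)) =
      ∑ y ∈ φ.range, (φ ⁻¹' {y}).indicator (fun x => f x y) := by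
    funext x
    rw [Finset.sum_apply, Finset.sum_eq_single (φ x)]
    · simp
    · intro y _ hy
      exact indicator_of_notMem (fun hx => hy (by simpa using hx.symm)) _
    · intro hx
      exact absurd (φ.mem_range_self x) hx
  rw [h]
  exact Finset.aemeasurable_sum _ fun y _ =>
    (hf.measurable y).indicator (φ.measurableSet_fiber y)

lemma IsLipCaratheodory.integrable_comp (hf : IsLipCaratheodory Ω ω f) (u : L1 Ω) :
    IntegrableOn (fun x => f x (u x)) Ω volume := by
  have hu := Lp.stronglyMeasurable u
  have hm : AEMeasurable (fun x => f x (u x)) (volume.restrict Ω) := by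
    -- Measurability is clear for simple functions, and Lipschitz continuity in r carries it to
    -- their pointwise limit u.
    refine aemeasurable_of_tendsto_metrizable_ae atTop
      (fun n => hf.aemeasurable_comp_simpleFunc (hu.approx n)) ?_
    filter_upwards [hf.lipschitz] with x hx
    rw [tendsto_iff_norm_sub_tendsto_zero]
    have hlim : Tendsto (fun n => ω * ‖hu.approx n x - u x‖) atTop (𝓝 (ω * 0)) :=
      (tendsto_iff_norm_sub_tendsto_zero.1 (hu.tendsto_approx x)).const_mul ω
    rw [mul_zero] at hlim
    exact squeeze_zero (fun _ => norm_nonneg _) (fun n => hx _ _) hlim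
  refine ((L1.integrable_coeFn u).norm.const_mul ω).mono' hm.aestronglyMeasurable ?_
  filter_upwards [hf.lipschitz, hf.zero] with x hx h0
  simpa [h0] using hx (u x) 0

end Nemytskii

/-! ### Differential inequality and Gronwall -/

section Comparison

variable {d : ℕ} {Ω : Set (Eucl d)} {s p T ω : ℝ} {f : Eucl d → ℝ → ℝ} {φ : ℝ → ℝ}

lemma setIntegral_pos_sub_eq (u₁ u₂ g₁ g₂ : L1 Ω) :
    ∫ x in {x | 0 < (u₁ - u₂) x}, (g₁ - g₂) x ∂(volume.restrict Ω) =
      ∫ x in Ω, ({x | u₂ x < u₁ x} : Set (Eucl d)).indicator (fun x => g₁ x - g₂ x) x := by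
  rw [← integral_indicator (measurableSet_pos _)]
  refine integral_congr_ae ?_
  filter_upwards [Lp.coeFn_sub u₁ u₂, Lp.coeFn_sub g₁ g₂] with x hx hx'
  simp only [indicator_apply, mem_ofPred_eq, hx, hx', Pi.sub_apply, sub_pos]

/-- The differential inequality for `∫ (u₁ - u₂)⁺` at a fixed time. -/
lemma setIntegral_deriv_le (hp : 1 < p) (hΩ : MeasurableSet Ω) (hf : IsLipCaratheodory Ω ω f)
    (hφ : StrictMono φ) {u₁ u₂ g₁ g₂ v₁ v₂ : L1 Ω} {b₁ b₂ : Eucl d → ℝ}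
    (hw₁ : MemWsp s p fun x => φ (extend Ω u₁ b₁ x))
    (hw₂ : MemWsp s p fun x => φ (extend Ω u₂ b₂ x))
    (he₁ : IsFracPLaplacian Ω s p (fun x => φ (extend Ω u₁ b₁ x))
      (fun x => g₁ x - f x (u₁ x) - v₁ x))
    (he₂ : IsFracPLaplacian Ω s p (fun x => φ (extend Ω u₂ b₂ x))
      (fun x => g₂ x - f x (u₂ x) - v₂ x))
    (hle : ∀ᵐ x ∂((volume : Measure (Eucl d)).restrict Ωᶜ), b₁ x ≤ b₂ x) :
    ∫ x in {x | 0 < (u₁ - u₂) x}, (v₁ - v₂) x ∂(volume.restrict Ω) ≤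
      (∫ x in {x | 0 < (u₁ - u₂) x}, (g₁ - g₂) x ∂(volume.restrict Ω)) +
        ω * ∫ x in Ω, max ((u₁ - u₂) x) 0 := by
  have hk : ∀ g u v : L1 Ω, IntegrableOn (fun x => g x - f x (u x) - v x) Ω volume :=
    fun g u v => ((L1.integrable_coeFn g).sub (hf.integrable_comp u)).sub (L1.integrable_coeFn v)
  have h0 := integral_indicator_lt_nonneg hp hw₁ hw₂ (hk _ _ _) (hk _ _ _) he₁ he₂ (by
    filter_upwards [hle, ae_restrict_mem hΩ.compl] with x hx hxΩ
    have hxΩ : x ∉ Ω := hxΩ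
    simpa [extend, hxΩ] using hφ.monotone hx)
  set S : Set (Eucl d) := {x | 0 < (u₁ - u₂) x} with hS
  have hSm : MeasurableSet S := measurableSet_pos _
  have iv := (L1.integrable_coeFn (v₁ - v₂)).indicator hSm
  have ig := (L1.integrable_coeFn (g₁ - g₂)).indicator hSm
  have iu := (integrable_max_zero (u₁ - u₂)).const_mul ω
  have igu : Integrable (fun x => S.indicator (⇑(g₁ - g₂)) x + ω * max ((u₁ - u₂) x) 0)
    (volume.restrict Ω) := ig.add iu
  rw [← integral_indicator hSm, ← integral_indicator hSm, ← integral_const_mul, ← integral_add ig iu,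
    ← sub_nonneg, ← integral_sub igu iv]
  -- Strict monotonicity of φ identifies the two sets within Ω, up to a null set.
  have h1 : ∫ x in Ω, {x | φ (extend Ω u₂ b₂ x) < φ (extend Ω u₁ b₁ x)}.indicator
        (fun x => (g₁ x - f x (u₁ x) - v₁ x) - (g₂ x - f x (u₂ x) - v₂ x)) x =
      ∫ x in Ω, S.indicator
        (fun x => (g₁ x - f x (u₁ x) - v₁ x) - (g₂ x - f x (u₂ x) - v₂ x)) x := by
    refine integral_congr_ae ?_
    filter_upwards [Lp.coeFn_sub u₁ u₂, ae_restrict_mem hΩ] with x hu hxΩ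
    simp only [indicator_apply, hS, mem_ofPred_eq, hu, Pi.sub_apply, sub_pos, extend, hxΩ,
      if_true, hφ.lt_iff_lt]
  rw [h1] at h0
  refine h0.trans (integral_mono_ae (((hk g₁ u₁ v₁).sub (hk g₂ u₂ v₂)).indicator hSm)
    (igu.sub iv) ?_)
  filter_upwards [Lp.coeFn_sub u₁ u₂, Lp.coeFn_sub g₁ g₂, Lp.coeFn_sub v₁ v₂, hf.lipschitz]
    with x hu hg hv hx
  simp only [indicator_apply, hS, mem_ofPred_eq, hu, hg, hv, Pi.sub_apply, sub_pos]
  split_ifs with h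
  -- On S the Lipschitz bound reads f(x, u₁) - f(x, u₂) ≥ -ω(u₁ - u₂).
  · have h3 := neg_le_of_abs_le (hx (u₁ x) (u₂ x))
    rw [abs_of_pos (sub_pos.2 h)] at h3
    rw [max_eq_left (sub_pos.2 h).le]
    linarith
  · rw [max_eq_right (by linarith)]
    simp

/-- Gronwall's inequality in integrated form for absolutely continuous functions. -/
lemma le_exp_mul_add_integral_of_ae_deriv_le {F B : ℝ → ℝ} {t : ℝ} (ht : 0 ≤ t)
    (hF : AbsolutelyContinuousOnInterval F 0 t) (hB : IntervalIntegrable B volume 0 t)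
    (hd : ∀ᵐ r ∂((volume : Measure ℝ).restrict (Ioo 0 t)), deriv F r ≤ B r + ω * F r) :
    F t ≤ Real.exp (ω * t) * F 0 + ∫ r in (0 : ℝ)..t, Real.exp (ω * (t - r)) * B r := by
  -- The integrating factor exp(-ωr) absorbs ωF; the product stays absolutely continuous, so it is
  -- the integral of its derivative.
  have hE : AbsolutelyContinuousOnInterval (fun r => Real.exp (-(ω * r))) 0 t :=
    ContDiffOn.absolutelyContinuousOnInterval (by fun_prop)
  have hEF := hE.fun_mul hF
  have hEB : IntervalIntegrable (fun r => Real.exp (-(ω * r)) * B r) volume 0 t :=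
    hB.continuousOn_mul (by fun_prop)
  have hle : ∫ r in (0 : ℝ)..t, deriv (fun r => Real.exp (-(ω * r)) * F r) r ≤
      ∫ r in (0 : ℝ)..t, Real.exp (-(ω * r)) * B r := by
    refine intervalIntegral.integral_mono_ae_restrict ht hEF.intervalIntegrable_deriv hEB ?_
    rw [← restrict_Ioo_eq_restrict_Icc]
    filter_upwards [hd, ae_restrict_of_ae hF.ae_differentiableAt, ae_restrict_mem measurableSet_Ioo]
      with r hr hdiff hrt
    have hFr := (hdiff (by rw [uIcc_of_le ht]; exact Ioo_subset_Icc_self hrt)).hasDerivAt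
    have hexp : HasDerivAt (fun r => Real.exp (-(ω * r))) (Real.exp (-(ω * r)) * -(ω * 1)) r :=
      ((hasDerivAt_id r).const_mul ω).neg.exp
    rw [(hexp.fun_mul hFr).deriv]
    have := mul_le_mul_of_nonneg_left hr (Real.exp_pos (-(ω * r))).le
    linarith
  rw [hEF.integral_deriv_eq_sub] at hle
  simp only [mul_zero, neg_zero, Real.exp_zero, one_mul] at hle
  have hsplit : ∫ r in (0 : ℝ)..t, Real.exp (ω * (t - r)) * B r =
      Real.exp (ω * t) * ∫ r in (0 : ℝ)..t, Real.exp (-(ω * r)) * B r := by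
    rw [← intervalIntegral.integral_const_mul]
    refine intervalIntegral.integral_congr fun r _ => ?_
    rw [← mul_assoc, ← Real.exp_add]
    congr 2
    ring
  have hmul := mul_le_mul_of_nonneg_left hle (Real.exp_pos (ω * t)).le
  rw [mul_sub, ← mul_assoc, ← Real.exp_add, add_neg_cancel, Real.exp_zero, one_mul] at hmul
  rw [hsplit]
  linarith

end Comparison

end FracDNL

/-! ### The comparison theorem -/

theorem theorem7p1 (d : ℕ) (hd : 1 ≤ d) (s p T ω : ℝ) (hs0 : 0 < s) (hs1 : s < 1) (hp : 1 < p)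
    (hT : 0 < T) (Ω : Set (FracDNL.Eucl d)) (hΩ : IsOpen Ω)
    (f : FracDNL.Eucl d → ℝ → ℝ) (hf : FracDNL.IsLipCaratheodory Ω ω f)
    (φ : ℝ → ℝ) (hφ : StrictMono φ) (hφ0 : φ 0 = 0)
    (y₁ y₂ : FracDNL.L1 Ω) (g₁ g₂ : ℝ → FracDNL.L1 Ω)
    (hg₁ : IntegrableOn g₁ (Ioo 0 T) volume) (hg₂ : IntegrableOn g₂ (Ioo 0 T) volume)
    (h₁ h₂ : ℝ → FracDNL.Eucl d → ℝ)
    (hh₁ : ∀ᵐ t ∂((volume : Measure ℝ).restrict (Ioo 0 T)),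
      LocallyIntegrableOn (h₁ t) Ωᶜ volume)
    (hh₂ : ∀ᵐ t ∂((volume : Measure ℝ).restrict (Ioo 0 T)),
      LocallyIntegrableOn (h₂ t) Ωᶜ volume)
    (u₁ u₂ : ℝ → FracDNL.L1 Ω)
    (hu₁ : FracDNL.IsStrongDistribSolution Ω s p T φ f g₁ h₁ y₁ u₁)
    (hu₂ : FracDNL.IsStrongDistribSolution Ω s p T φ f g₂ h₂ y₂ u₂)
    (hle : ∀ᵐ t ∂((volume : Measure ℝ).restrict (Ioo 0 T)),
      ∀ᵐ x ∂((volume : Measure (FracDNL.Eucl d)).restrict Ωᶜ), h₁ t x ≤ h₂ t x) :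
    ∀ t ∈ Icc (0 : ℝ) T,
      (∫ x in Ω, max (u₁ t x - u₂ t x) 0) ≤
        Real.exp (ω * t) * (∫ x in Ω, max (y₁ x - y₂ x) 0)
          + (∫ r in (0 : ℝ)..t, Real.exp (ω * (t - r)) *
              (∫ x in Ω, ({x | u₂ r x < u₁ r x} : Set (FracDNL.Eucl d)).indicator
                (fun x => g₁ r x - g₂ r x) x)) := by
  have hΩm : MeasurableSet Ω := hΩ.measurableSet
  have hW : FracDNL.MemW11 T (fun t => u₁ t - u₂ t) := hu₁.memW11.sub hu₂.memW11
  have hAC := hW.absolutelyContinuousOnInterval hT.le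
  have hFAC : AbsolutelyContinuousOnInterval
      (fun r => ∫ x in Ω, max ((u₁ r - u₂ r : FracDNL.L1 Ω) x) 0) 0 T :=
    hAC.of_dist_le fun x _ y _ => by
      rw [Real.dist_eq, dist_eq_norm]
      exact FracDNL.abs_integral_max_zero_sub_le _ _
  have hUm : AEStronglyMeasurable (fun t => u₁ t - u₂ t) (volume.restrict (Ioo 0 T)) := by
    have hc := hAC.continuousOn
    rw [uIcc_of_le hT.le] at hc
    exact ((hc.mono Ioo_subset_Icc_self).aestronglyMeasurable measurableSet_Ioo)
  have hB := FracDNL.integrable_setIntegral_pos hUm (hg₁.sub hg₂)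
  have hd : ∀ᵐ r ∂((volume : Measure ℝ).restrict (Ioo 0 T)),
      deriv (fun r => ∫ x in Ω, max ((u₁ r - u₂ r : FracDNL.L1 Ω) x) 0) r ≤
        (∫ x in {x | 0 < (u₁ r - u₂ r) x}, (g₁ r - g₂ r) x ∂(volume.restrict Ω)) +
          ω * ∫ x in Ω, max ((u₁ r - u₂ r : FracDNL.L1 Ω) x) 0 := by
    filter_upwards [hu₁.equation, hu₂.equation, hle, ae_restrict_of_ae hFAC.ae_differentiableAt,
      ae_restrict_mem measurableSet_Ioo] with r e₁ e₂ hr hdiff hrT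
    obtain ⟨d₁, ⟨w₁, -⟩, e₁⟩ := e₁
    obtain ⟨d₂, ⟨w₂, -⟩, e₂⟩ := e₂
    -- Almost every time is a point of differentiability of both solutions in L¹ and of F, as the
    -- chain rule requires.
    have hdr := hdiff (by rw [uIcc_of_le hT.le]; exact Ioo_subset_Icc_self hrT)
    rw [FracDNL.deriv_integral_max_zero (d₁.fun_sub d₂) hdr, deriv_fun_sub d₁ d₂]
    exact FracDNL.setIntegral_deriv_le hp hΩm hf hφ w₁ w₂ e₁ e₂ hr
  have hF : ∀ v₁ v₂ : FracDNL.L1 Ω, ∫ x in Ω, max ((v₁ - v₂ : FracDNL.L1 Ω) x) 0 =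
      ∫ x in Ω, max (v₁ x - v₂ x) 0 := fun v₁ v₂ => by
    refine integral_congr_ae ?_
    filter_upwards [Lp.coeFn_sub v₁ v₂] with x hx
    rw [hx, Pi.sub_apply]
  intro t ht
  have hBt : IntervalIntegrable
      (fun r => ∫ x in {x | 0 < (u₁ r - u₂ r) x}, (g₁ r - g₂ r) x ∂(volume.restrict Ω))
      volume 0 t :=
    (intervalIntegrable_iff_integrableOn_Ioo_of_le ht.1).2
      (IntegrableOn.mono_set hB (Ioo_subset_Ioo_right ht.2))
  have key := FracDNL.le_exp_mul_add_integral_of_ae_deriv_le ht.1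
    (hFAC.mono (by rw [uIcc_of_le ht.1, uIcc_of_le hT.le]; exact Icc_subset_Icc_right ht.2)) hBt
    (ae_restrict_of_ae_restrict_of_subset (Ioo_subset_Ioo_right ht.2) hd)
  simp only [hF, FracDNL.setIntegral_pos_sub_eq, hu₁.initial, hu₂.initial] at key
  exact key
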